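/- Let $N\ge 1$ be an integer and let $\varphi=(\varphi_1,\varphi_2)\in H^N_c=H^N\times H^N$, where $H^m$ denotes the Sobolev space of $1$-periodic complex-valued functions whose weak derivatives of order $0,\dots,m$ are in $L^2$ on a period (so $H^0=L^2$). Define $$r_1:=-\varphi_2,\qquad r_{n+1}:=r_n'+\varphi_1\sum_{k=1}^{n-1}r_k\,r_{n-k}\qquad(1\le n\le N),$$ $$s_1:=-\varphi_1,\qquad s_{n+1}:=-s_n'+\varphi_2\sum_{k=1}^{n-1}s_k\,s_{n-k}\qquad(1\le n\le N),$$ where $'$ is the weak derivative and empty sums are $0$ (so $r_2=-\varphi_2'$, $s_2=\varphi_1'$), and for $\lambda\in\mathbb C\setminus\{0\}$ let $$\alpha_N(x,\lambda):=-i\sum_{n=1}^N\frac{r_n(x)}{(2i\lambda)^n},\qquad \beta_N(x,\lambda):=-i\sum_{n=1}^N\frac{s_n(x)}{(2i\lambda)^n}.$$ Then for every $1\le k\le N+1$ the coefficients are well defined with $r_k,s_k\in H^{N+1-k}$, the products $\varphi_1r_k$ and $\varphi_2s_k$ are integrable on $[0,1]$, and $$\int_0^1\varphi_1\,r_k\,dx=\int_0^1\varphi_2\,s_k\,dx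 .$$ Consequently, for every $\lambda\in\mathbb C\setminus\{0\}$, $$\int_0^1\varphi_1(x)\,\alpha_N(x,\lambda)\,dx=\int_0^1\varphi_2(x)\,\beta_N(x,\lambda)\,dx .$$ -/

import Mathlib

open MeasureTheory
open scoped ContDiff

namespace ZakharovShabat

noncomputable section

/-- `f` represents an element of the space `L²` of 1-periodic complex-valued functions. -/
def IsPeriodicL2 (f : ℝ → ℂ) : Prop :=
  Function.Periodic f 1 ∧ MemLp f 2 (volume.restrict (Set.Ioc (0 : ℝ) 1))

/-- `g ∈ L²` is a weak derivative of `f ∈ L²` (both 1-periodic), tested against all smooth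
1-periodic functions. -/
def IsWeakDeriv (f g : ℝ → ℂ) : Prop :=
  IsPeriodicL2 f ∧ IsPeriodicL2 g ∧
    ∀ ψ : ℝ → ℂ, ContDiff ℝ ∞ ψ → Function.Periodic ψ 1 →
      ∫ x in (0 : ℝ)..1, f x * deriv ψ x = -∫ x in (0 : ℝ)..1, g x * ψ x

/-- Membership in the Sobolev space `H^n` of 1-periodic complex-valued functions:
`f` and its weak derivatives up to order `n` are in `L²`. -/
def MemSobolev : ℕ → (ℝ → ℂ) → Prop
  | 0, f => IsPeriodicL2 f
  | n + 1, f => ∃ g : ℝ → ℂ, IsWeakDeriv f g ∧ MemSobolev n g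

open Classical in
/-- A representative of the weak derivative (unique almost everywhere) of `f`, with value `0`
if there is none in `L²`. -/
def weakDeriv (f : ℝ → ℂ) : ℝ → ℂ :=
  if h : ∃ g : ℝ → ℂ, IsWeakDeriv f g then Classical.choose h else 0

/-- The functions `c₁ = -q`, `cₙ₊₁ = σ cₙ' + p ∑_{k=1}^{n-1} c_k c_{n-k}` for `n ≥ 1`.
The value at index `0` is a dummy. -/
def wkbCoeff (σ : ℂ) (p q : ℝ → ℂ) : ℕ → ℝ → ℂ
  | 0 => 0
  | 1 => -q
  | n + 2 => fun x =>
      σ * weakDeriv (wkbCoeff σ p q (n + 1)) x +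
        p x * ∑ k ∈ (Finset.Icc 1 n).attach,
          wkbCoeff σ p q k.1 x * wkbCoeff σ p q (n + 1 - k.1) x
  decreasing_by
    · omega
    · have := Finset.mem_Icc.1 k.2
      omega
    · have := Finset.mem_Icc.1 k.2
      omega

/-- The coefficients `r_k` of the potential `(φ₁, φ₂)`. -/
def r (φ₁ φ₂ : ℝ → ℂ) (k : ℕ) : ℝ → ℂ := wkbCoeff 1 φ₁ φ₂ k

/-- The coefficients `s_k` of the potential `(φ₁, φ₂)`. -/
def s (φ₁ φ₂ : ℝ → ℂ) (k : ℕ) : ℝ → ℂ := wkbCoeff (-1) φ₂ φ₁ k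

/-- `α_N(x, z)`, where `i α_N(x, z) = ∑_{n=1}^N r_n(x) / (2iz)^n`, for `z ≠ 0`. -/
def alpha (φ₁ φ₂ : ℝ → ℂ) (N : ℕ) (x : ℝ) (z : ℂ) : ℂ :=
  -Complex.I * ∑ n ∈ Finset.Icc 1 N, r φ₁ φ₂ n x / (2 * Complex.I * z) ^ n

/-- `β_N(x, z)`, where `i β_N(x, z) = ∑_{n=1}^N s_n(x) / (2iz)^n`, for `z ≠ 0`. -/
def beta (φ₁ φ₂ : ℝ → ℂ) (N : ℕ) (x : ℝ) (z : ℂ) : ℂ :=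
  -Complex.I * ∑ n ∈ Finset.Icc 1 N, s φ₁ φ₂ n x / (2 * Complex.I * z) ^ n

theorem wkbCoeff_succ (σ : ℂ) (p q : ℝ → ℂ) (n : ℕ) (hn : 1 ≤ n) (x : ℝ) :
    wkbCoeff σ p q (n + 1) x = σ * weakDeriv (wkbCoeff σ p q n) x +
      p x * ∑ k ∈ Finset.Icc 1 (n - 1), wkbCoeff σ p q k x * wkbCoeff σ p q (n - k) x := by
  obtain ⟨m, rfl⟩ : ∃ m, n = m + 1 := ⟨n - 1, by omega⟩
  rw [wkbCoeff]
  beta_reduce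
  rw [Finset.sum_attach (Finset.Icc 1 m)
    (fun k => wkbCoeff σ p q k x * wkbCoeff σ p q (m + 1 - k) x)]
  simp

theorem r_one (φ₁ φ₂ : ℝ → ℂ) : r φ₁ φ₂ 1 = -φ₂ := by simp [r, wkbCoeff]

theorem s_one (φ₁ φ₂ : ℝ → ℂ) : s φ₁ φ₂ 1 = -φ₁ := by simp [s, wkbCoeff]

theorem r_succ (φ₁ φ₂ : ℝ → ℂ) (n : ℕ) (hn : 1 ≤ n) (x : ℝ) :
    r φ₁ φ₂ (n + 1) x = weakDeriv (r φ₁ φ₂ n) x +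
      φ₁ x * ∑ k ∈ Finset.Icc 1 (n - 1), r φ₁ φ₂ k x * r φ₁ φ₂ (n - k) x := by
  have h := wkbCoeff_succ 1 φ₁ φ₂ n hn x
  rw [one_mul] at h
  exact h

theorem s_succ (φ₁ φ₂ : ℝ → ℂ) (n : ℕ) (hn : 1 ≤ n) (x : ℝ) :
    s φ₁ φ₂ (n + 1) x = -weakDeriv (s φ₁ φ₂ n) x +
      φ₂ x * ∑ k ∈ Finset.Icc 1 (n - 1), s φ₁ φ₂ k x * s φ₁ φ₂ (n - k) x := by
  have h := wkbCoeff_succ (-1) φ₂ φ₁ n hn x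
  rw [neg_one_mul] at h
  exact h

end

end ZakharovShabat

/-!
Fix a point `x` and collect the coefficients in formal power series `R = ∑ rₖ(x) Xᵏ` and
`S = ∑ sₖ(x) Xᵏ`. The recursions are the Riccati equations `R = X (R' - φ₂ + φ₁ R²)` and
`S = X (-S' - φ₁ + φ₂ S²)`, where `'` is the coefficientwise weak derivative (`wkbSeries_eq`).
They give `(R S)' = D (1 + R S)` with `D = φ₂ S - φ₁ R` (`mul_deriv_eq`), that is,
`D = (log (1 + R S))'`. So each coefficient `φ₂ sₖ - φ₁ rₖ` of `D` is the derivative of a periodic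
function and integrates to zero.

The logarithm is avoided by the Euler operator `E = X d/dX`: the series `Q = E (R S) / (1 + R S)`
has derivative `E D`, whose coefficient of index `k` is `k` times that of `D`
(`euler_eq_of_deriv_eq_mul`, `integral_coeff_eq_zero`). The coefficient of index `k` of `Q` is a
polynomial in the `rᵢ` and `sᵢ` with `i < k` only, since `R` and `S` have no constant term; up to
`k = N + 1` these functions are in `H¹`, although `r_{N+1}` and `s_{N+1}` are merely in `L²`.

The analytic input is the product rule for weak derivatives (`IsWeakDeriv.mul`). By Parseval's
identity, a function with weak derivative `g` is almost everywhere equal to a primitive of `g`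
(`IsWeakDeriv.exists_isPrimitive`), and for primitives the product rule follows from absolute
continuity (`IsPrimitive.mul`). It also shows that the product of functions in `H^n` and `H^(n+1)`
is in `H^n` (`MemSobolev.mul_succ`), whence the regularity of the coefficients
(`memSobolev_wkbCoeff`).
-/

namespace ZakharovShabat

/-! ### Primitives of integrable functions on a period -/

/-- `F` is a primitive of the integrable function `f` on `[0, 1]`. The values of `F` outside the
interval are irrelevant. -/
def IsPrimitive (F f : ℝ → ℂ) : Prop :=
  IntervalIntegrable f volume 0 1 ∧
    ∀ x ∈ Set.Icc (0 : ℝ) 1, F x = F 0 + ∫ t in (0 : ℝ)..x, f t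

theorem isPrimitive_integral {f : ℝ → ℂ} (hf : IntervalIntegrable f volume 0 1) (c : ℂ) :
    IsPrimitive (fun x => c + ∫ t in (0 : ℝ)..x, f t) f :=
  ⟨hf, fun x _ => by simp⟩

theorem IsPrimitive.of_contDiff {ψ : ℝ → ℂ} (hψ : ContDiff ℝ ∞ ψ) :
    IsPrimitive ψ (deriv ψ) := by
  have hc : Continuous (deriv ψ) := hψ.continuous_deriv (by simp)
  refine ⟨hc.intervalIntegrable 0 1, fun x _ => ?_⟩
  rw [intervalIntegral.integral_deriv_eq_sub
    (fun y _ => (hψ.differentiable (by simp)).differentiableAt) (hc.intervalIntegrable 0 x)]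
  ring

theorem IsPrimitive.absolutelyContinuousOnInterval {F f : ℝ → ℂ} (h : IsPrimitive F f) :
    AbsolutelyContinuousOnInterval F 0 1 := by
  have hG := h.1.norm.absolutelyContinuousOnInterval_intervalIntegral
    (c := 0) (by simp)
  unfold AbsolutelyContinuousOnInterval at hG ⊢
  refine squeeze_zero' ?_ ?_ hG
  · exact Filter.Eventually.of_forall fun _ => Finset.sum_nonneg fun i _ => dist_nonneg
  rw [Filter.eventually_inf_principal]
  refine Filter.Eventually.of_forall ?_
  rintro ⟨n, I⟩ hI
  refine Finset.sum_le_sum fun i hi => ?_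
  obtain ⟨hx, hy⟩ := hI.1 i hi
  dsimp only at hx hy ⊢
  have hint : ∀ {x y : ℝ}, x ∈ Set.uIcc (0 : ℝ) 1 → y ∈ Set.uIcc (0 : ℝ) 1 →
      IntervalIntegrable f volume x y :=
    fun hx hy => h.1.mono_set (Set.uIcc_subset_uIcc hx hy)
  have h0 : (0 : ℝ) ∈ Set.uIcc (0 : ℝ) 1 := by simp
  have hx' : (I i).1 ∈ Set.Icc (0 : ℝ) 1 := by simpa using hx
  have hy' : (I i).2 ∈ Set.Icc (0 : ℝ) 1 := by simpa using hy
  rw [dist_eq_norm, Real.dist_eq, h.2 _ hx', h.2 _ hy', add_sub_add_left_eq_sub,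
    intervalIntegral.integral_interval_sub_left (hint h0 hx) (hint h0 hy),
    intervalIntegral.integral_interval_sub_left (hint h0 hx).norm (hint h0 hy).norm]
  exact intervalIntegral.norm_integral_le_abs_integral_norm

theorem IsPrimitive.continuousOn {F f : ℝ → ℂ} (h : IsPrimitive F f) :
    ContinuousOn F (Set.uIcc 0 1) :=
  h.absolutelyContinuousOnInterval.continuousOn

theorem IsPrimitive.memLp_top {F f : ℝ → ℂ} (h : IsPrimitive F f) :
    MemLp F ⊤ (volume.restrict (Set.Ioc (0 : ℝ) 1)) := by
  obtain ⟨C, hC⟩ := h.absolutelyContinuousOnInterval.exists_bound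
  have hsub : Set.Ioc (0 : ℝ) 1 ⊆ Set.uIcc 0 1 := by
    rw [Set.uIcc_of_le zero_le_one]
    exact Set.Ioc_subset_Icc_self
  exact memLp_top_of_bound
    ((h.continuousOn.mono hsub).aestronglyMeasurable measurableSet_Ioc) C
    (ae_restrict_of_forall_mem measurableSet_Ioc fun x hx => hC x (hsub hx))

theorem IsPrimitive.ae_hasDerivAt {F f : ℝ → ℂ} (h : IsPrimitive F f) :
    ∀ᵐ x, x ∈ Set.uIcc (0 : ℝ) 1 → HasDerivAt F (f x) x := by
  have h1 : ∀ᵐ x : ℝ, x ≠ 1 := by simp [ae_iff, measure_singleton]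
  have h0 : ∀ᵐ x : ℝ, x ≠ 0 := by simp [ae_iff, measure_singleton]
  filter_upwards [h.1.ae_hasDerivAt_integral, h0, h1] with x hx hx0 hx1 hmem
  have hd := (hx hmem 0 (by simp)).const_add (F 0)
  rw [Set.uIcc_of_le zero_le_one] at hmem
  refine hd.congr_of_eventuallyEq ?_
  filter_upwards [Icc_mem_nhds (lt_of_le_of_ne hmem.1 hx0.symm) (lt_of_le_of_ne hmem.2 hx1)]
    with y hy
  exact h.2 y hy

theorem IsPrimitive.mul_add_integrable {F f G g : ℝ → ℂ} (hF : IsPrimitive F f)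
    (hG : IsPrimitive G g) :
    IntervalIntegrable (fun x => f x * G x + F x * g x) volume 0 1 :=
  (hF.1.mul_continuousOn hG.continuousOn).add (hG.1.continuousOn_mul hF.continuousOn)

/-- The product rule for absolutely continuous functions: the difference of `F * G` and the
candidate primitive is absolutely continuous with derivative zero almost everywhere. -/
theorem IsPrimitive.mul {F f G g : ℝ → ℂ} (hF : IsPrimitive F f) (hG : IsPrimitive G g) :
    IsPrimitive (fun x => F x * G x) (fun x => f x * G x + F x * g x) := by
  have hint := hF.mul_add_integrable hG
  have hP := isPrimitive_integral hint 0
  have hFG : AbsolutelyContinuousOnInterval (fun x => F x * G x) 0 1 :=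
    hF.absolutelyContinuousOnInterval.smul hG.absolutelyContinuousOnInterval
  obtain ⟨C, hC⟩ := (hFG.sub hP.absolutelyContinuousOnInterval).const_of_ae_hasDerivAt_zero (by
    filter_upwards [hF.ae_hasDerivAt, hG.ae_hasDerivAt, hP.ae_hasDerivAt] with x h1 h2 h3 hx
    have := ((h1 hx).mul (h2 hx)).sub (h3 hx)
    rw [sub_self] at this
    exact this)
  refine ⟨hint, fun x hx => ?_⟩
  have e0 := hC 0 (by simp)
  have ex := hC x (by rwa [Set.uIcc_of_le zero_le_one])
  simp only [Pi.sub_apply, intervalIntegral.integral_same, zero_add, sub_zero] at e0 ex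
  linear_combination ex - e0

/-! ### Periodic square integrable functions and their Fourier coefficients -/

theorem IsPeriodicL2.intervalIntegrable {f : ℝ → ℂ} (hf : IsPeriodicL2 f) :
    IntervalIntegrable f volume 0 1 := by
  rw [intervalIntegrable_iff_integrableOn_Ioc_of_le zero_le_one]
  exact hf.2.integrable (by norm_num)

theorem IsPeriodicL2.mul_intervalIntegrable {f g : ℝ → ℂ} (hf : IsPeriodicL2 f)
    (hg : IsPeriodicL2 g) : IntervalIntegrable (fun x => f x * g x) volume 0 1 := by
  rw [intervalIntegrable_iff_integrableOn_Ioc_of_le zero_le_one]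
  exact hf.2.integrable_mul hg.2

theorem IsPeriodicL2.add {f g : ℝ → ℂ} (hf : IsPeriodicL2 f) (hg : IsPeriodicL2 g) :
    IsPeriodicL2 (fun x => f x + g x) :=
  ⟨hf.1.add hg.1, hf.2.add hg.2⟩

theorem IsPeriodicL2.const_mul {f : ℝ → ℂ} (c : ℂ) (hf : IsPeriodicL2 f) :
    IsPeriodicL2 (fun x => c * f x) :=
  ⟨fun x => congrArg (c * ·) (hf.1 x), hf.2.const_mul c⟩

theorem isPeriodicL2_zero : IsPeriodicL2 (fun _ => 0) :=
  ⟨fun _ => rfl, MemLp.zero⟩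

theorem contDiff_exp_int (n : ℤ) :
    ContDiff ℝ ∞ (fun x : ℝ => Complex.exp (2 * Real.pi * Complex.I * n * x)) :=
  (contDiff_const.mul Complex.ofRealCLM.contDiff).cexp

theorem periodic_exp_int (n : ℤ) :
    Function.Periodic (fun x : ℝ => Complex.exp (2 * Real.pi * Complex.I * n * x)) 1 := by
  intro x
  have : (2 * Real.pi * Complex.I * n * ((x + 1 : ℝ) : ℂ)) =
      2 * Real.pi * Complex.I * n * x + n * (2 * Real.pi * Complex.I) := by push_cast; ring
  simp only [this]
  rw [Complex.exp_add, Complex.exp_int_mul_two_pi_mul_I, mul_one]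

theorem deriv_exp_int (n : ℤ) (x : ℝ) :
    deriv (fun x : ℝ => Complex.exp (2 * Real.pi * Complex.I * n * x)) x =
      2 * Real.pi * Complex.I * n * Complex.exp (2 * Real.pi * Complex.I * n * x) := by
  have h := ((Complex.ofRealCLM.hasDerivAt (x := x)).const_mul (2 * Real.pi * Complex.I * n)).cexp
  simp only [Complex.ofRealCLM_apply, Complex.ofReal_one, mul_one] at h
  rw [h.deriv]
  ring

/-- An `L²` function on a period all of whose Fourier coefficients vanish is zero, by Parseval. -/
theorem ae_eq_zero_of_integral_mul_exp {f : ℝ → ℂ}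
    (hf : MemLp f 2 (volume.restrict (Set.Ioc (0 : ℝ) 1)))
    (h : ∀ n : ℤ, ∫ x in (0 : ℝ)..1, f x * Complex.exp (2 * Real.pi * Complex.I * n * x) = 0) :
    f =ᵐ[volume.restrict (Set.Ioc (0 : ℝ) 1)] 0 := by
  have hz : ∀ n : ℤ, fourierCoeffOn zero_lt_one f n = 0 := by
    intro n
    rw [fourierCoeffOn_eq_integral]
    have : ∀ x : ℝ, fourier (-n) (x : AddCircle ((1 : ℝ) - 0)) • f x =
        f x * Complex.exp (2 * Real.pi * Complex.I * (-n : ℤ) * x) := by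
      intro x
      rw [fourier_coe_apply, smul_eq_mul, mul_comm]
      norm_num
    simp_rw [this, h (-n), smul_zero]
  have hs := hasSum_sq_fourierCoeffOn zero_lt_one hf
  simp only [hz, norm_zero, ne_eq, OfNat.ofNat_ne_zero, not_false_eq_true, zero_pow] at hs
  have h0 := hs.unique hasSum_zero
  rw [sub_zero, inv_one, one_smul, intervalIntegral.integral_of_le zero_le_one,
    integral_eq_zero_iff_of_nonneg (fun x => by positivity)
      ((memLp_two_iff_integrable_sq_norm hf.1).1 hf)] at h0
  filter_upwards [h0] with x hx
  simpa using hx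

/-! ### Weak derivatives -/

theorem IsWeakDeriv.integral_eq_zero {f g : ℝ → ℂ} (h : IsWeakDeriv f g) :
    ∫ x in (0 : ℝ)..1, g x = 0 := by
  have := h.2.2 (fun _ => 1) contDiff_const (fun _ => rfl)
  simpa using this.symm

theorem IsWeakDeriv.ae_unique {f g g' : ℝ → ℂ} (h : IsWeakDeriv f g) (h' : IsWeakDeriv f g') :
    g =ᵐ[volume.restrict (Set.Ioc (0 : ℝ) 1)] g' := by
  have := ae_eq_zero_of_integral_mul_exp (h.2.1.2.sub h'.2.1.2) (fun n => by
    have hc := (contDiff_exp_int n).continuous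
    have e := h.2.2 _ (contDiff_exp_int n) (periodic_exp_int n)
    rw [h'.2.2 _ (contDiff_exp_int n) (periodic_exp_int n), neg_inj] at e
    simp only [Pi.sub_apply, sub_mul]
    rw [intervalIntegral.integral_sub
      (h.2.1.intervalIntegrable.mul_continuousOn hc.continuousOn)
      (h'.2.1.intervalIntegrable.mul_continuousOn hc.continuousOn), e, sub_self])
  filter_upwards [this] with x hx
  exact sub_eq_zero.1 hx

theorem integral_exp_int {n : ℤ} (hn : n ≠ 0) :
    ∫ x in (0 : ℝ)..1, Complex.exp (2 * Real.pi * Complex.I * n * x) = 0 := by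
  have hc : (2 * Real.pi * Complex.I * n : ℂ) ≠ 0 := by
    simp [Real.pi_ne_zero, hn]
  have h := (IsPrimitive.of_contDiff (contDiff_exp_int n)).2 1 (by simp)
  have hp := periodic_exp_int n 0
  simp only [zero_add] at hp
  simp only [deriv_exp_int, intervalIntegral.integral_const_mul, hp] at h
  simpa [hc] using h

/-- A function in `H¹` is almost everywhere equal to an absolutely continuous function, which takes
the same value at both ends of the period. The difference of `f` and the primitive `G` of its weak
derivative is orthogonal to all derivatives of test functions, so that it has no Fourier
coefficients but the zeroth, and is constant. -/
theorem IsWeakDeriv.exists_isPrimitive {f g : ℝ → ℂ} (h : IsWeakDeriv f g) :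
    ∃ F, IsPrimitive F g ∧ F 1 = F 0 ∧ f =ᵐ[volume.restrict (Set.Ioc (0 : ℝ) 1)] F := by
  have hg := h.2.1.intervalIntegrable
  set G : ℝ → ℂ := fun x => 0 + ∫ t in (0 : ℝ)..x, g t with hGdef
  have hG : IsPrimitive G g := isPrimitive_integral hg 0
  have hG0 : G 0 = 0 := by simp [hGdef]
  have hG1 : G 1 = 0 := by simp [hGdef, h.integral_eq_zero]
  have hGL : MemLp G 2 (volume.restrict (Set.Ioc (0 : ℝ) 1)) := by
    exact hG.memLp_top.mono_exponent le_top
  set c : ℂ := ∫ x in (0 : ℝ)..1, (f x - G x) with hc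
  have hfG : IntervalIntegrable (fun x => f x - G x) volume 0 1 :=
    h.1.intervalIntegrable.sub (hG.continuousOn.intervalIntegrable)
  have hzero := ae_eq_zero_of_integral_mul_exp
    (f := fun x => f x - G x - c) ((h.1.2.sub hGL).sub (memLp_const c)) (fun n => by
      have hcont := (contDiff_exp_int n).continuous
      simp only [sub_mul _ c]
      rw [intervalIntegral.integral_sub (hfG.mul_continuousOn hcont.continuousOn)
        ((hcont.const_mul c).intervalIntegrable 0 1),
        intervalIntegral.integral_const_mul]
      rcases eq_or_ne n 0 with rfl | hn
      · simp [← hc]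
      rw [integral_exp_int hn, mul_zero, sub_zero]
      have hk : (2 * Real.pi * Complex.I * n : ℂ) ≠ 0 := by
        simp [Real.pi_ne_zero, hn]
      have e1 := h.2.2 _ (contDiff_exp_int n) (periodic_exp_int n)
      have hψ := IsPrimitive.of_contDiff (contDiff_exp_int n)
      have e2 := (hG.mul hψ).2 1 (by simp)
      simp only [hG0, hG1, zero_mul, zero_add] at e2
      rw [intervalIntegral.integral_add (hG.1.mul_continuousOn hψ.continuousOn)
        (hψ.1.continuousOn_mul hG.continuousOn)] at e2
      have e3 : ∫ x in (0 : ℝ)..1, (f x - G x) *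
          deriv (fun x : ℝ => Complex.exp (2 * Real.pi * Complex.I * n * x)) x = 0 := by
        simp only [sub_mul]
        rw [intervalIntegral.integral_sub
          (h.1.intervalIntegrable.mul_continuousOn
            ((contDiff_exp_int n).continuous_deriv (by simp)).continuousOn)
          (hψ.1.continuousOn_mul hG.continuousOn), e1]
        linear_combination e2
      have e4 : ∀ x : ℝ, (f x - G x) *
          deriv (fun x : ℝ => Complex.exp (2 * Real.pi * Complex.I * n * x)) x =
          (2 * Real.pi * Complex.I * n) *
            ((f x - G x) * Complex.exp (2 * Real.pi * Complex.I * n * x)) := by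
        intro x
        rw [deriv_exp_int]
        ring
      simp only [e4, intervalIntegral.integral_const_mul] at e3
      exact (mul_eq_zero.1 e3).resolve_left hk)
  refine ⟨fun x => c + ∫ t in (0 : ℝ)..x, g t, isPrimitive_integral hg c, ?_, ?_⟩
  · simp [h.integral_eq_zero]
  · filter_upwards [hzero] with x hx
    simp only [hGdef, Pi.zero_apply] at hx
    linear_combination hx

theorem IsWeakDeriv.of_isPrimitive {f g F : ℝ → ℂ} (hf : IsPeriodicL2 f) (hg : IsPeriodicL2 g)
    (hF : IsPrimitive F g) (hF1 : F 1 = F 0)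
    (hfF : f =ᵐ[volume.restrict (Set.Ioc (0 : ℝ) 1)] F) : IsWeakDeriv f g := by
  refine ⟨hf, hg, fun ψ hψ hper => ?_⟩
  have hP := IsPrimitive.of_contDiff hψ
  have e := (hF.mul hP).2 1 (by simp)
  have hψ1 : ψ 1 = ψ 0 := by simpa using hper 0
  simp only [hF1, hψ1] at e
  rw [intervalIntegral.integral_add (hF.1.mul_continuousOn hP.continuousOn)
    (hP.1.continuousOn_mul hF.continuousOn)] at e
  have e' : ∫ x in (0 : ℝ)..1, f x * deriv ψ x = ∫ x in (0 : ℝ)..1, F x * deriv ψ x := by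
    rw [intervalIntegral.integral_of_le zero_le_one, intervalIntegral.integral_of_le zero_le_one]
    refine integral_congr_ae ?_
    filter_upwards [hfF] with x hx
    rw [hx]
  rw [e']
  linear_combination -e

theorem IsWeakDeriv.memLp_top {f g : ℝ → ℂ} (h : IsWeakDeriv f g) :
    MemLp f ⊤ (volume.restrict (Set.Ioc (0 : ℝ) 1)) := by
  obtain ⟨F, hF, -, hfF⟩ := h.exists_isPrimitive
  exact hF.memLp_top.ae_eq hfF.symm

theorem IsPeriodicL2.mul_isWeakDeriv {f g g' : ℝ → ℂ} (hf : IsPeriodicL2 f)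
    (hg : IsWeakDeriv g g') : IsPeriodicL2 (fun x => f x * g x) :=
  ⟨hf.1.mul hg.1.1, hg.memLp_top.mul' hf.2⟩

theorem IsWeakDeriv.mul {f f' g g' : ℝ → ℂ} (hf : IsWeakDeriv f f') (hg : IsWeakDeriv g g') :
    IsWeakDeriv (fun x => f x * g x) (fun x => f' x * g x + f x * g' x) := by
  obtain ⟨F, hF, hF1, hfF⟩ := hf.exists_isPrimitive
  obtain ⟨G, hG, hG1, hgG⟩ := hg.exists_isPrimitive
  have hL : IsPeriodicL2 (fun x => f' x * g x + f x * g' x) := by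
    refine (hf.2.1.mul_isWeakDeriv hg).add ?_
    simpa only [mul_comm] using hg.2.1.mul_isWeakDeriv hf
  have hP := hF.mul hG
  have hae : (fun x => f' x * G x + F x * g' x) =ᵐ[volume.restrict (Set.Ioc (0 : ℝ) 1)]
      fun x => f' x * g x + f x * g' x := by
    filter_upwards [hfF, hgG] with x h1 h2
    rw [h1, h2]
  refine IsWeakDeriv.of_isPrimitive (hf.1.mul_isWeakDeriv hg) hL
    (F := fun x => F x * G x) ⟨hL.intervalIntegrable, fun x hx => ?_⟩ (by simp [hF1, hG1]) ?_
  · rw [hP.2 x hx, intervalIntegral.integral_of_le hx.1, intervalIntegral.integral_of_le hx.1]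
    congr 1
    exact integral_congr_ae (ae_restrict_of_ae_restrict_of_subset
      (Set.Ioc_subset_Ioc_right hx.2) hae)
  · filter_upwards [hfF, hgG] with x h1 h2
    rw [h1, h2]

theorem IsWeakDeriv.add {f f' g g' : ℝ → ℂ} (hf : IsWeakDeriv f f') (hg : IsWeakDeriv g g') :
    IsWeakDeriv (fun x => f x + g x) (fun x => f' x + g' x) := by
  refine ⟨hf.1.add hg.1, hf.2.1.add hg.2.1, fun ψ hψ hper => ?_⟩
  have hd : ContinuousOn (deriv ψ) (Set.uIcc 0 1) := (hψ.continuous_deriv (by simp)).continuousOn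
  have hc : ContinuousOn ψ (Set.uIcc 0 1) := hψ.continuous.continuousOn
  simp only [add_mul]
  rw [intervalIntegral.integral_add (hf.1.intervalIntegrable.mul_continuousOn hd)
    (hg.1.intervalIntegrable.mul_continuousOn hd),
    intervalIntegral.integral_add (hf.2.1.intervalIntegrable.mul_continuousOn hc)
    (hg.2.1.intervalIntegrable.mul_continuousOn hc), hf.2.2 ψ hψ hper, hg.2.2 ψ hψ hper]
  ring

theorem IsWeakDeriv.const_mul {f f' : ℝ → ℂ} (c : ℂ) (hf : IsWeakDeriv f f') :
    IsWeakDeriv (fun x => c * f x) (fun x => c * f' x) := by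
  refine ⟨hf.1.const_mul c, hf.2.1.const_mul c, fun ψ hψ hper => ?_⟩
  simp only [mul_assoc, intervalIntegral.integral_const_mul]
  rw [hf.2.2 ψ hψ hper]
  ring

theorem isWeakDeriv_zero : IsWeakDeriv (fun _ => 0) (fun _ => 0) :=
  ⟨isPeriodicL2_zero, isPeriodicL2_zero, by simp⟩

theorem IsWeakDeriv.sum {ι : Type*} (t : Finset ι) {f f' : ι → ℝ → ℂ}
    (h : ∀ i ∈ t, IsWeakDeriv (f i) (f' i)) :
    IsWeakDeriv (fun x => ∑ i ∈ t, f i x) (fun x => ∑ i ∈ t, f' i x) := by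
  classical
  induction t using Finset.induction_on with
  | empty => simpa using isWeakDeriv_zero
  | insert a t ha ih =>
    simp only [Finset.sum_insert ha]
    exact (h a (Finset.mem_insert_self a t)).add
      (ih fun i hi => h i (Finset.mem_insert_of_mem hi))

theorem IsWeakDeriv.isWeakDeriv_weakDeriv {f g : ℝ → ℂ} (h : IsWeakDeriv f g) :
    IsWeakDeriv f (weakDeriv f) := by
  have he : ∃ g, IsWeakDeriv f g := ⟨g, h⟩
  rw [weakDeriv, dif_pos he]
  exact Classical.choose_spec he

/-! ### Sobolev spaces -/

theorem MemSobolev.isPeriodicL2 : ∀ {n : ℕ} {f : ℝ → ℂ}, MemSobolev n f → IsPeriodicL2 f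
  | 0, _, h => h
  | _ + 1, _, ⟨_, h, _⟩ => h.1

theorem MemSobolev.of_succ : ∀ {n : ℕ} {f : ℝ → ℂ}, MemSobolev (n + 1) f → MemSobolev n f
  | 0, _, ⟨_, h, _⟩ => h.1
  | _ + 1, _, ⟨g, h, hg⟩ => ⟨g, h, hg.of_succ⟩

theorem MemSobolev.mono {m n : ℕ} (hmn : m ≤ n) {f : ℝ → ℂ} (h : MemSobolev n f) :
    MemSobolev m f := by
  induction n, hmn using Nat.le_induction with
  | base => exact h
  | succ n _ ih => exact ih h.of_succ

theorem MemSobolev.isWeakDeriv {n : ℕ} (hn : 1 ≤ n) {f : ℝ → ℂ} (h : MemSobolev n f) :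
    IsWeakDeriv f (weakDeriv f) := by
  obtain ⟨g, hg, -⟩ := h.mono hn
  exact hg.isWeakDeriv_weakDeriv

theorem MemSobolev.congr_ae {n : ℕ} {f g : ℝ → ℂ} (h : MemSobolev n f)
    (hper : Function.Periodic g 1) (hfg : f =ᵐ[volume.restrict (Set.Ioc (0 : ℝ) 1)] g) :
    MemSobolev n g := by
  cases n with
  | zero => exact ⟨hper, MemLp.ae_eq hfg h.2⟩
  | succ n =>
    obtain ⟨f', hf', hn⟩ := h
    obtain ⟨F, hF, hF1, hfF⟩ := hf'.exists_isPrimitive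
    exact ⟨f', .of_isPrimitive ⟨hper, MemLp.ae_eq hfg hf'.1.2⟩ hf'.2.1 hF hF1
      (hfg.symm.trans hfF), hn⟩

theorem MemSobolev.weakDeriv {n : ℕ} {f : ℝ → ℂ} (h : MemSobolev (n + 1) f) :
    MemSobolev n (weakDeriv f) := by
  obtain ⟨g, hg, hn⟩ := h
  have hw := hg.isWeakDeriv_weakDeriv
  exact hn.congr_ae hw.2.1.1 (hg.ae_unique hw)

theorem MemSobolev.add : ∀ {n : ℕ} {f g : ℝ → ℂ}, MemSobolev n f → MemSobolev n g →
    MemSobolev n (fun x => f x + g x)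
  | 0, _, _, hf, hg => IsPeriodicL2.add hf hg
  | _ + 1, _, _, ⟨_, hf, hf'⟩, ⟨_, hg, hg'⟩ => ⟨_, hf.add hg, hf'.add hg'⟩

theorem MemSobolev.const_mul (c : ℂ) : ∀ {n : ℕ} {f : ℝ → ℂ}, MemSobolev n f →
    MemSobolev n (fun x => c * f x)
  | 0, _, hf => IsPeriodicL2.const_mul c hf
  | _ + 1, _, ⟨_, hf, hf'⟩ => ⟨_, hf.const_mul c, hf'.const_mul c⟩

theorem memSobolev_zero_fun : ∀ n : ℕ, MemSobolev n (fun _ => 0)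
  | 0 => isPeriodicL2_zero
  | n + 1 => ⟨_, isWeakDeriv_zero, memSobolev_zero_fun n⟩

theorem MemSobolev.sum {ι : Type*} {n : ℕ} (t : Finset ι) {f : ι → ℝ → ℂ}
    (h : ∀ i ∈ t, MemSobolev n (f i)) : MemSobolev n (fun x => ∑ i ∈ t, f i x) := by
  classical
  induction t using Finset.induction_on with
  | empty => simpa using memSobolev_zero_fun n
  | insert a t ha ih =>
    simp only [Finset.sum_insert ha]
    exact (h a (Finset.mem_insert_self a t)).add
      (ih fun i hi => h i (Finset.mem_insert_of_mem hi))

/-- `H^(n+1)` multiplies `H^n` into itself. The extra derivative on one factor makes this hold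
from `n = 0` on, where it says that functions in `H¹` are bounded. -/
theorem MemSobolev.mul_succ {n : ℕ} {f g : ℝ → ℂ} (hf : MemSobolev n f)
    (hg : MemSobolev (n + 1) g) : MemSobolev n (fun x => f x * g x) := by
  induction n generalizing f g with
  | zero =>
    obtain ⟨g', hg', -⟩ := hg
    exact IsPeriodicL2.mul_isWeakDeriv hf hg'
  | succ n ih =>
    have hf' := hf
    have hg' := hg
    obtain ⟨f₁, hf₁, hf₁n⟩ := hf
    obtain ⟨g₁, hg₁, hg₁n⟩ := hg
    refine ⟨_, hf₁.mul hg₁, (ih hf₁n hg'.of_succ).add ?_⟩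
    simpa only [mul_comm] using ih hg₁n.of_succ hf'


/-! ### Regularity of the coefficients -/

theorem wkbCoeff_zero (σ : ℂ) (p q : ℝ → ℂ) : wkbCoeff σ p q 0 = 0 := by
  rw [wkbCoeff]

theorem wkbCoeff_one (σ : ℂ) (p q : ℝ → ℂ) : wkbCoeff σ p q 1 = -q := by
  rw [wkbCoeff]

theorem memSobolev_wkbCoeff (σ : ℂ) {N : ℕ} {p q : ℝ → ℂ} (hp : MemSobolev N p)
    (hq : MemSobolev N q) (k : ℕ) (hk1 : 1 ≤ k) (hkN : k ≤ N + 1) :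
    MemSobolev (N + 1 - k) (wkbCoeff σ p q k) := by
  induction k using Nat.strong_induction_on with
  | _ k ih =>
    obtain rfl | ⟨n, hn, rfl⟩ : k = 1 ∨ ∃ n, 1 ≤ n ∧ k = n + 1 := by
      rcases Nat.eq_or_lt_of_le hk1 with h | h
      · exact .inl h.symm
      · exact .inr ⟨k - 1, by omega, by omega⟩
    · rw [wkbCoeff_one, Nat.add_sub_cancel, show -q = fun x => -1 * q x by ext; simp]
      exact hq.const_mul (-1)
    · rw [funext fun x => wkbCoeff_succ σ p q n hn x]
      have hn' := ih n (by omega) hn (by omega)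
      rw [show N + 1 - n = N + 1 - (n + 1) + 1 by omega] at hn'
      refine (hn'.weakDeriv.const_mul σ).add ?_
      simp only [mul_comm (p _)]
      refine (MemSobolev.sum _ fun i hi => ?_).mul_succ (hp.mono (by omega))
      obtain ⟨hi1, hi2⟩ := Finset.mem_Icc.1 hi
      exact ((ih i (by omega) hi1 (by omega)).mono (by omega)).mul_succ
        ((ih (n - i) (by omega) (by omega) (by omega)).mono (by omega))

/-! ### The logarithmic derivative of the generating functions -/

open PowerSeries

/-- The generating function `∑ₖ cₖ(x) Xᵏ` of the coefficients at the point `x`. -/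
noncomputable def wkbSeries (σ : ℂ) (p q : ℝ → ℂ) (x : ℝ) : PowerSeries ℂ :=
  PowerSeries.mk fun k => wkbCoeff σ p q k x

/-- The generating function `∑ₖ cₖ'(x) Xᵏ` of the weak derivatives of the coefficients. The dummy
coefficient at index `0` is the zero function, but its chosen weak derivative vanishes only almost
everywhere, hence the case distinction. -/
noncomputable def wkbDerivSeries (σ : ℂ) (p q : ℝ → ℂ) (x : ℝ) : PowerSeries ℂ :=
  PowerSeries.mk fun k => if k = 0 then 0 else weakDeriv (wkbCoeff σ p q k) x

/-- The recursion for the coefficients is a Riccati equation for their generating function. -/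
theorem wkbSeries_eq (σ : ℂ) (p q : ℝ → ℂ) (x : ℝ) :
    wkbSeries σ p q x = X * (C σ * wkbDerivSeries σ p q x - C (q x) +
      C (p x) * wkbSeries σ p q x ^ 2) := by
  ext k
  obtain _ | _ | n := k
  · simp [wkbSeries, wkbCoeff_zero]
  · rw [coeff_succ_X_mul]
    simp [wkbSeries, wkbDerivSeries, wkbCoeff_zero, wkbCoeff_one]
  · rw [coeff_succ_X_mul, map_add, map_sub, coeff_C_mul, coeff_C_mul, coeff_C, if_neg (by omega),
      sq, coeff_mul, Finset.Nat.sum_antidiagonal_eq_sum_range_succ_mk]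
    simp only [wkbSeries, wkbDerivSeries, coeff_mk]
    rw [wkbCoeff_succ σ p q (n + 1) (by omega), if_neg (by omega), sub_zero]
    congr 2
    refine Finset.sum_subset (fun i hi => ?_) (fun i hi hi' => ?_)
    · simp only [Finset.mem_Icc, Finset.mem_range] at hi ⊢
      omega
    · simp only [Finset.mem_Icc, Finset.mem_range] at hi hi'
      obtain rfl | rfl : i = 0 ∨ i = n + 1 := by omega
      · simp [wkbCoeff_zero]
      · simp [wkbCoeff_zero]

/-- If `P' = D P` for a further derivation `'`, then `E P / P` has derivative `E D`, where `E` is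
the Euler operator `X d/dX`: both solve the equation got by applying `E` to `P' = D P`. Here `'`
is only known through `P'`, and the conclusion is the recursion that determines the coefficients
of the derivative of `Q = E P / P`, with `P = 1 + W`. -/
theorem euler_eq_of_deriv_eq_mul {W W' D Q : PowerSeries ℂ} (hW : W' = D * (1 + W))
    (hQ : Q * (1 + W) = X * derivative ℂ W) :
    X * derivative ℂ D = X * derivative ℂ W' - (X * derivative ℂ D * W + Q * W') := by
  subst hW
  simp only [Derivation.leibniz, map_add, Derivation.map_one_eq_zero, smul_eq_mul]
  linear_combination D * hQ

theorem exists_mul_eq_euler (W : PowerSeries ℂ) (h0 : constantCoeff W = 0) :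
    ∃ Q : PowerSeries ℂ, Q * (1 + W) = X * derivative ℂ W :=
  ⟨X * derivative ℂ W * (1 + W)⁻¹, by
    rw [mul_assoc, PowerSeries.inv_mul_cancel _ (by simp [h0]), mul_one]⟩

theorem coeff_euler (W : PowerSeries ℂ) (n : ℕ) :
    coeff n (X * derivative ℂ W) = n * coeff n W := by
  cases n with
  | zero => simp
  | succ n => rw [coeff_succ_X_mul, coeff_derivative]; push_cast; ring

/-- If the coefficients of `W` are weakly differentiable with derivatives the coefficients of
`W' = D (1 + W)`, then formally `D = (log (1 + W))'`, so that the coefficients of `D` integrate to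
zero over a period. -/
theorem integral_coeff_eq_zero {M : ℕ} {W W' D : ℝ → PowerSeries ℂ}
    (h0 : ∀ x, constantCoeff (W x) = 0) (h0' : ∀ x, constantCoeff (W' x) = 0)
    (hW : ∀ x, W' x = D x * (1 + W x))
    (hd : ∀ n ≤ M, IsWeakDeriv (fun x => coeff n (W x)) (fun x => coeff n (W' x)))
    {n : ℕ} (hn1 : 1 ≤ n) (hnM : n ≤ M) : ∫ x in (0 : ℝ)..1, coeff n (D x) = 0 := by
  choose Q hQ using fun x => exists_mul_eq_euler (W x) (h0 x)
  have key : ∀ n ≤ M, IsWeakDeriv (fun x => coeff n (Q x))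
      (fun x => coeff n (X * derivative ℂ (D x))) := by
    intro n
    induction n using Nat.strong_induction_on with
    | _ n ih =>
      intro hn
      have e1 : ∀ x, coeff n (Q x) = n * coeff n (W x) +
          (-1) * ∑ ij ∈ Finset.HasAntidiagonal.antidiagonal n,
            coeff ij.1 (Q x) * coeff ij.2 (W x) := by
        intro x
        rw [← coeff_euler, ← coeff_mul, ← hQ x, mul_add, mul_one, map_add]
        ring
      have e2 : ∀ x, coeff n (X * derivative ℂ (D x)) = n * coeff n (W' x) +
          (-1) * ∑ ij ∈ Finset.HasAntidiagonal.antidiagonal n,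
            (coeff ij.1 (X * derivative ℂ (D x)) * coeff ij.2 (W x) +
              coeff ij.1 (Q x) * coeff ij.2 (W' x)) := by
        intro x
        rw [Finset.sum_add_distrib, ← coeff_mul, ← coeff_mul, ← coeff_euler, neg_one_mul,
          ← sub_eq_add_neg, ← map_add, ← map_sub, ← euler_eq_of_deriv_eq_mul (hW x) (hQ x)]
      rw [funext e1, funext e2]
      refine ((hd n hn).const_mul n).add (IsWeakDeriv.const_mul (-1) (IsWeakDeriv.sum _ ?_))
      rintro ⟨i, j⟩ hij
      rw [Finset.HasAntidiagonal.mem_antidiagonal] at hij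
      dsimp only at hij ⊢
      rcases Nat.eq_zero_or_pos j with rfl | hj
      · -- the top coefficient of `Q` is multiplied by the vanishing constant coefficient of `W`,
        -- so the induction hypothesis is not needed there
        simpa [h0, h0'] using isWeakDeriv_zero
      · exact (ih i (by omega) (by omega)).mul (hd j (by omega))
  have hz := (key n hnM).integral_eq_zero
  simp only [coeff_euler, intervalIntegral.integral_const_mul] at hz
  exact (mul_eq_zero.1 hz).resolve_left (by exact_mod_cast (by omega : n ≠ 0))

theorem wkbSeries_constantCoeff (σ : ℂ) (p q : ℝ → ℂ) (x : ℝ) :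
    constantCoeff (wkbSeries σ p q x) = 0 := by
  rw [wkbSeries_eq]
  simp

/-- The derivation of `φ₂ s - φ₁ r = (log (1 + r s))'` from the Riccati equations. -/
theorem mul_deriv_eq (φ₁ φ₂ : ℝ → ℂ) (x : ℝ) :
    wkbDerivSeries 1 φ₁ φ₂ x * wkbSeries (-1) φ₂ φ₁ x +
        wkbSeries 1 φ₁ φ₂ x * wkbDerivSeries (-1) φ₂ φ₁ x =
      (C (φ₂ x) * wkbSeries (-1) φ₂ φ₁ x - C (φ₁ x) * wkbSeries 1 φ₁ φ₂ x) *
        (1 + wkbSeries 1 φ₁ φ₂ x * wkbSeries (-1) φ₂ φ₁ x) := by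
  have hr := wkbSeries_eq 1 φ₁ φ₂ x
  have hs := wkbSeries_eq (-1) φ₂ φ₁ x
  simp only [map_one, map_neg] at hr hs
  apply mul_left_cancel₀ (X_ne_zero (R := ℂ))
  set R := wkbSeries 1 φ₁ φ₂ x
  set S := wkbSeries (-1) φ₂ φ₁ x
  linear_combination -S * hr + R * hs

theorem isWeakDeriv_coeff_mul {N : ℕ} {φ₁ φ₂ : ℝ → ℂ} (h₁ : MemSobolev N φ₁)
    (h₂ : MemSobolev N φ₂) {n : ℕ} (hn : n ≤ N + 1) :
    IsWeakDeriv (fun x => coeff n (wkbSeries 1 φ₁ φ₂ x * wkbSeries (-1) φ₂ φ₁ x))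
      (fun x => coeff n (wkbDerivSeries 1 φ₁ φ₂ x * wkbSeries (-1) φ₂ φ₁ x +
        wkbSeries 1 φ₁ φ₂ x * wkbDerivSeries (-1) φ₂ φ₁ x)) := by
  simp only [map_add, coeff_mul, ← Finset.sum_add_distrib]
  refine IsWeakDeriv.sum _ ?_
  rintro ⟨i, j⟩ hij
  rw [Finset.HasAntidiagonal.mem_antidiagonal] at hij
  simp only [wkbSeries, wkbDerivSeries, coeff_mk] at hij ⊢
  -- the boundary terms vanish, so that no derivative of the coefficient of index `N + 1` occurs
  rcases Nat.eq_zero_or_pos i with rfl | hi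
  · simpa [wkbCoeff_zero] using isWeakDeriv_zero
  rcases Nat.eq_zero_or_pos j with rfl | hj
  · simpa [wkbCoeff_zero] using isWeakDeriv_zero
  simp only [if_neg hi.ne', if_neg hj.ne']
  exact ((memSobolev_wkbCoeff 1 h₁ h₂ i hi (by omega)).isWeakDeriv (by omega)).mul
    ((memSobolev_wkbCoeff (-1) h₂ h₁ j hj (by omega)).isWeakDeriv (by omega))

theorem mul_wkbCoeff_intervalIntegrable (σ : ℂ) {N : ℕ} {p q : ℝ → ℂ} (hp : MemSobolev N p)
    (hq : MemSobolev N q) {k : ℕ} (hk1 : 1 ≤ k) (hkN : k ≤ N + 1) :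
    IntervalIntegrable (fun x => p x * wkbCoeff σ p q k x) volume 0 1 :=
  hp.isPeriodicL2.mul_intervalIntegrable
    (memSobolev_wkbCoeff σ hp hq k hk1 hkN).isPeriodicL2

theorem integral_mul_r_eq_integral_mul_s {N : ℕ} {φ₁ φ₂ : ℝ → ℂ} (h₁ : MemSobolev N φ₁)
    (h₂ : MemSobolev N φ₂) {k : ℕ} (hk1 : 1 ≤ k) (hkN : k ≤ N + 1) :
    ∫ x in (0 : ℝ)..1, φ₁ x * r φ₁ φ₂ k x = ∫ x in (0 : ℝ)..1, φ₂ x * s φ₁ φ₂ k x := by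
  have h := integral_coeff_eq_zero (M := N + 1)
    (fun x => by simp [wkbSeries_constantCoeff])
    (fun x => by simp [wkbSeries_constantCoeff])
    (mul_deriv_eq φ₁ φ₂) (fun n hn => isWeakDeriv_coeff_mul h₁ h₂ hn) hk1 hkN
  simp only [map_sub, coeff_C_mul, wkbSeries, coeff_mk] at h
  rw [intervalIntegral.integral_sub (mul_wkbCoeff_intervalIntegrable (-1) h₂ h₁ hk1 hkN)
    (mul_wkbCoeff_intervalIntegrable 1 h₁ h₂ hk1 hkN)] at h
  exact (sub_eq_zero.1 h).symm

end ZakharovShabat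

theorem lemma3p1 (N : ℕ) (hN : 1 ≤ N) (φ₁ φ₂ : ℝ → ℂ)
    (h₁ : ZakharovShabat.MemSobolev N φ₁) (h₂ : ZakharovShabat.MemSobolev N φ₂) :
    (∀ k : ℕ, 1 ≤ k → k ≤ N + 1 →
      ZakharovShabat.MemSobolev (N + 1 - k) (ZakharovShabat.r φ₁ φ₂ k) ∧
      ZakharovShabat.MemSobolev (N + 1 - k) (ZakharovShabat.s φ₁ φ₂ k) ∧
      IntervalIntegrable (fun x => φ₁ x * ZakharovShabat.r φ₁ φ₂ k x) volume 0 1 ∧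
      IntervalIntegrable (fun x => φ₂ x * ZakharovShabat.s φ₁ φ₂ k x) volume 0 1 ∧
      ∫ x in (0 : ℝ)..1, φ₁ x * ZakharovShabat.r φ₁ φ₂ k x =
        ∫ x in (0 : ℝ)..1, φ₂ x * ZakharovShabat.s φ₁ φ₂ k x) ∧
    ∀ z : ℂ, z ≠ 0 →
      ∫ x in (0 : ℝ)..1, φ₁ x * ZakharovShabat.alpha φ₁ φ₂ N x z =
        ∫ x in (0 : ℝ)..1, φ₂ x * ZakharovShabat.beta φ₁ φ₂ N x z := by
  have hri : ∀ k, 1 ≤ k → k ≤ N + 1 →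
      IntervalIntegrable (fun x => φ₁ x * ZakharovShabat.r φ₁ φ₂ k x) volume 0 1 :=
    fun k => ZakharovShabat.mul_wkbCoeff_intervalIntegrable 1 h₁ h₂
  have hsi : ∀ k, 1 ≤ k → k ≤ N + 1 →
      IntervalIntegrable (fun x => φ₂ x * ZakharovShabat.s φ₁ φ₂ k x) volume 0 1 :=
    fun k => ZakharovShabat.mul_wkbCoeff_intervalIntegrable (-1) h₂ h₁
  refine ⟨fun k hk1 hkN => ⟨ZakharovShabat.memSobolev_wkbCoeff 1 h₁ h₂ k hk1 hkN,
    ZakharovShabat.memSobolev_wkbCoeff (-1) h₂ h₁ k hk1 hkN, hri k hk1 hkN, hsi k hk1 hkN,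
    ZakharovShabat.integral_mul_r_eq_integral_mul_s h₁ h₂ hk1 hkN⟩, fun z _ => ?_⟩
  -- for each side, the integral of a finite linear combination of the functions treated above
  have hsum : ∀ (p : ℝ → ℂ) (c : ℕ → ℝ → ℂ),
      (∀ k, 1 ≤ k → k ≤ N + 1 → IntervalIntegrable (fun x => p x * c k x) volume 0 1) →
      ∫ x in (0 : ℝ)..1, p x *
          (-Complex.I * ∑ n ∈ Finset.Icc 1 N, c n x / (2 * Complex.I * z) ^ n) =
        ∑ n ∈ Finset.Icc 1 N,
          (-Complex.I / (2 * Complex.I * z) ^ n) * ∫ x in (0 : ℝ)..1, p x * c n x := by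
    intro p c hc
    simp only [← intervalIntegral.integral_const_mul]
    rw [← intervalIntegral.integral_finsetSum fun n hn => by
      obtain ⟨hn1, hnN⟩ := Finset.mem_Icc.1 hn
      exact (hc n hn1 (by omega)).const_mul _]
    refine intervalIntegral.integral_congr fun x _ => ?_
    simp only [Finset.mul_sum]
    exact Finset.sum_congr rfl fun n _ => by ring
  simp only [ZakharovShabat.alpha, ZakharovShabat.beta]
  rw [hsum _ _ hri, hsum _ _ hsi]
  refine Finset.sum_congr rfl fun n hn => ?_
  obtain ⟨hn1, hnN⟩ := Finset.mem_Icc.1 hn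
  rw [ZakharovShabat.integral_mul_r_eq_integral_mul_s h₁ h₂ hn1 (by omega)]
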